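/- Let $G$ be a compactly generated, totally disconnected, locally compact (Hausdorff) topological group that is topologically simple (non-trivial, with no closed normal subgroups other than $\{e\}$ and $G$) and non-discrete. A subgroup of $G$ is called locally normal if it is compact and its normaliser in $G$ is open. Let $\mathcal{LN}(G)$ be the set of commensurability classes of locally normal subgroups of $G$, let $0\in\mathcal{LN}(G)$ be the class of the trivial subgroup, and let $\infty\in\mathcal{LN}(G)$ be the class of the compact open subgroups. For $\alpha\in\mathcal{LN}(G)$ let $\alpha^\perp\in\mathcal{LN}(G)$ be the class of the centraliser $\mathrm{C}_U(K)$, where $U$ is a compact open subgroup of $G$ and $K$ is a representative of $\alpha$ that is a closed normal subgroup of $U$ (this class depends only on $\alpha$). Put $\mathcal{LC}(G)=\{\alpha^\perp \mid \alpha\in\mathcal{LN}(G)\}$. Theorem. If $\mathcal{LC}(G)\neq\{0,\infty\}$, then the given topology of $G$ is the unique $\sigma$-compact locally compact Hausdorff group topology on the abstract group $G$: it is $\sigma$-compact, and every $\sigma$-compact locally compact Hausdorff topology on $G$ making $G$ a topological group coincides with it. In particular, every automorphism of the abstract group $G$ is continuous. -/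

import Mathlib

/-- A topological group is compactly generated if some compact subset generates it as an
abstract group. -/
def IsCompactlyGeneratedGroup (G : Type*) [Group G] [TopologicalSpace G] : Prop :=
  ∃ S : Set G, IsCompact S ∧ Subgroup.closure S = ⊤

/-- A topological group is topologically simple if it is non-trivial and its only closed normal
subgroups are the trivial subgroup and the whole group. -/
def IsTopologicallySimpleGroup (G : Type*) [Group G] [TopologicalSpace G] : Prop :=
  Nontrivial G ∧ ∀ N : Subgroup G, N.Normal → IsClosed (N : Set G) → N = ⊥ ∨ N = ⊤

/-- A locally normal subgroup is a compact subgroup whose normaliser is open. -/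
def IsLocallyNormal {G : Type*} [Group G] [TopologicalSpace G] (K : Subgroup G) : Prop :=
  IsCompact (K : Set G) ∧ IsOpen (Subgroup.normalizer (K : Set G) : Set G)

/-- The type of locally normal subgroups of `G`. -/
abbrev LocallyNormalSubgroup (G : Type*) [Group G] [TopologicalSpace G] :=
  {K : Subgroup G // IsLocallyNormal K}

/-- Commensurability as an equivalence relation on locally normal subgroups. -/
def locallyNormalSetoid (G : Type*) [Group G] [TopologicalSpace G] :
    Setoid (LocallyNormalSubgroup G) where
  r K L := Subgroup.Commensurable K.1 L.1
  iseqv := ⟨fun K => Subgroup.Commensurable.refl K.1, fun h => h.symm, fun h h' => h.trans h'⟩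

/-- The (underlying set of the) structure lattice `LN(G)`: commensurability classes of locally
normal subgroups. -/
def StructureLattice (G : Type*) [Group G] [TopologicalSpace G] :=
  Quotient (locallyNormalSetoid G)

/-- The class in `LN(G)` of a locally normal subgroup. -/
def StructureLattice.mk {G : Type*} [Group G] [TopologicalSpace G] (K : Subgroup G)
    (hK : IsLocallyNormal K) : StructureLattice G :=
  Quotient.mk (locallyNormalSetoid G) ⟨K, hK⟩

theorem isLocallyNormal_bot (G : Type*) [Group G] [TopologicalSpace G] :
    IsLocallyNormal (⊥ : Subgroup G) := by
  refine ⟨by simp, ?_⟩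
  have h : Subgroup.normalizer ((⊥ : Subgroup G) : Set G) = ⊤ :=
    Subgroup.normalizer_eq_top_iff.2 inferInstance
  rw [h]
  exact isOpen_univ

theorem isLocallyNormal_of_isOpen {G : Type*} [Group G] [TopologicalSpace G]
    [IsTopologicalGroup G] {U : Subgroup G} (hc : IsCompact (U : Set G))
    (ho : IsOpen (U : Set G)) : IsLocallyNormal U :=
  ⟨hc, Subgroup.isOpen_mono Subgroup.le_normalizer ho⟩

/-- If `K` is a normal subgroup of a compact open subgroup `U`, then the centraliser of `K`
in `U` is locally normal. -/
theorem isLocallyNormal_inf_centralizer {G : Type*} [Group G] [TopologicalSpace G]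
    [IsTopologicalGroup G] [T2Space G] {K U : Subgroup G} (hc : IsCompact (U : Set G))
    (ho : IsOpen (U : Set G)) (hKU : K ≤ U) (hn : (K.subgroupOf U).Normal) :
    IsLocallyNormal (U ⊓ Subgroup.centralizer (K : Set G)) := by
  refine ⟨?_, Subgroup.isOpen_mono ?_ ho⟩
  · rw [Subgroup.coe_inf]
    exact hc.inter_right (Set.isClosed_centralizer (K : Set G))
  · have hN := (Subgroup.normal_subgroupOf_iff hKU).1 hn
    rw [Subgroup.le_normalizer_iff]
    rintro u hu c ⟨hcU, hcC⟩
    refine ⟨U.mul_mem (U.mul_mem hu hcU) (U.inv_mem hu), ?_⟩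
    have hcC' := Subgroup.mem_centralizer_iff.1 hcC
    refine Subgroup.mem_centralizer_iff.2 fun k hk => ?_
    have h1 : u⁻¹ * k * u ∈ K := by simpa using hN k u⁻¹ hk (U.inv_mem hu)
    have h2 := hcC' _ h1
    calc k * (u * c * u⁻¹) = u * ((u⁻¹ * k * u) * c) * u⁻¹ := by group
      _ = u * (c * (u⁻¹ * k * u)) * u⁻¹ := by rw [h2]
      _ = u * c * u⁻¹ * k := by group

/-- A totally disconnected locally compact group has a compact open subgroup. -/
theorem exists_compact_open_subgroup (G : Type*) [Group G] [TopologicalSpace G]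
    [IsTopologicalGroup G] [T2Space G] [LocallyCompactSpace G] [TotallyDisconnectedSpace G] :
    ∃ U : Subgroup G, IsCompact (U : Set G) ∧ IsOpen (U : Set G) := by
  obtain ⟨C, hC, h1C⟩ := exists_compact_mem_nhds (1 : G)
  obtain ⟨W, hW, h1W, hWC⟩ :=
    (loc_compact_Haus_tot_disc_of_zero_dim (H := G)).mem_nhds_iff.1 h1C
  have hW' : IsClopen W := hW
  have hWc : IsCompact W := hC.of_isClosed_subset hW'.1 hWC
  obtain ⟨V, hV, hWV⟩ := compact_open_separated_mul_right hWc hW'.2 subset_rfl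
  let H : Subgroup G :=
    { carrier := {g | ∀ w, w ∈ W ↔ w * g ∈ W}
      one_mem' := by simp
      mul_mem' := by
        intro a b ha hb w
        rw [ha w, hb (w * a), mul_assoc]
      inv_mem' := by
        intro a ha w
        rw [ha (w * a⁻¹), inv_mul_cancel_right] }
  have hHo : IsOpen (H : Set G) := by
    refine Subgroup.isOpen_of_mem_nhds H (g := 1) ?_
    refine Filter.mem_of_superset (Filter.inter_mem hV (inv_mem_nhds_one G hV)) ?_
    rintro g ⟨hg, hg'⟩ w
    refine ⟨fun hw => hWV (Set.mul_mem_mul hw hg), fun hw => ?_⟩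
    have := hWV (Set.mul_mem_mul hw (Set.mem_inv.1 hg'))
    rwa [mul_inv_cancel_right] at this
  refine ⟨H, hWc.of_isClosed_subset (Subgroup.isClosed_of_isOpen H hHo) ?_, hHo⟩
  intro g hg
  have h : (1 : G) ∈ W ↔ 1 * g ∈ W := hg 1
  rw [one_mul] at h
  exact h.1 h1W

/-- The minimum `0` of the structure lattice: the class of the trivial subgroup. -/
instance (G : Type*) [Group G] [TopologicalSpace G] : Zero (StructureLattice G) :=
  ⟨StructureLattice.mk ⊥ (isLocallyNormal_bot G)⟩

/-- The maximum `∞` of the structure lattice: the common class of the compact open subgroups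
(any two of them are commensurable, so the choice does not matter). -/
noncomputable def StructureLattice.infty (G : Type*) [Group G] [TopologicalSpace G]
    [IsTopologicalGroup G] [T2Space G] [LocallyCompactSpace G] [TotallyDisconnectedSpace G] :
    StructureLattice G :=
  StructureLattice.mk (exists_compact_open_subgroup G).choose
    (isLocallyNormal_of_isOpen (exists_compact_open_subgroup G).choose_spec.1
      (exists_compact_open_subgroup G).choose_spec.2)

/-- The graph of the operator `α ↦ α^⊥` on `LN(G)`: `β` is the class of the centraliser `C_U(K)`,
where `U` is a compact open subgroup of `G` and the representative `K` of `α` is a closed normal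
subgroup of `U`. For compactly generated, topologically simple, non-discrete `G` the class of
`C_U(K)` depends only on `α`, so that this relation is a function. -/
def StructureLattice.IsPerp {G : Type*} [Group G] [TopologicalSpace G]
    [IsTopologicalGroup G] [T2Space G] (α β : StructureLattice G) : Prop :=
  ∃ (K U : Subgroup G) (hK : IsLocallyNormal K) (hc : IsCompact (U : Set G))
    (ho : IsOpen (U : Set G)) (hKU : K ≤ U) (hn : (K.subgroupOf U).Normal),
    α = StructureLattice.mk K hK ∧
      β = StructureLattice.mk (U ⊓ Subgroup.centralizer (K : Set G))
        (isLocallyNormal_inf_centralizer hc ho hKU hn)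

/-- The centraliser lattice `LC(G) = {α^⊥ | α ∈ LN(G)}`, as a subset of `LN(G)`. -/
def centraliserLattice (G : Type*) [Group G] [TopologicalSpace G]
    [IsTopologicalGroup G] [T2Space G] : Set (StructureLattice G) :=
  {β | ∃ α : StructureLattice G, StructureLattice.IsPerp α β}

/-- `τ` is a σ-compact locally compact (Hausdorff) group topology on the abstract group `G`. -/
structure IsSigmaCompactLocallyCompactGroupTopology (G : Type*) [Group G]
    (τ : TopologicalSpace G) : Prop where
  isTopologicalGroup : @IsTopologicalGroup G τ _
  t2Space : @T2Space G τ
  locallyCompactSpace : @LocallyCompactSpace G τ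
  sigmaCompactSpace : @SigmaCompactSpace G τ

/-! ### σ-compactness, Baire category and closed graphs -/

open scoped Pointwise

/-! The topology is recovered from an open subgroup that is defined algebraically. If `LC(G)` is not
`{0, ∞}`, some `K` with open normaliser has a centraliser `C` other than `1` and `G`. Its normaliser
`N` is open, and simplicity makes the core of `N` trivial, since otherwise `C` would be a proper
non-trivial closed normal subgroup. Centralisers are closed in every Hausdorff group topology, hence
so is `N`. Being of countable index, `N` is then open in any other σ-compact locally compact
topology, by Baire. Thus the identity is continuous modulo each conjugate of `N`; these conjugates
intersect trivially, so its graph is closed, and the closed graph and open mapping theorems make it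
a homeomorphism. -/

theorem IsCompactlyGeneratedGroup.sigmaCompactSpace {G : Type*} [Group G] [TopologicalSpace G]
    [IsTopologicalGroup G] (h : IsCompactlyGeneratedGroup G) : SigmaCompactSpace G := by
  obtain ⟨S, hS, hgen⟩ := h
  -- `T n` consists of the words of length `n` in `S ∪ S⁻¹`.
  let T : ℕ → Set G := fun n => Nat.rec {1} (fun _ A => (S ∪ S⁻¹) * A) n
  have hT : ∀ n, IsCompact (T n) := by
    intro n
    induction n with
    | zero => exact isCompact_singleton
    | succ n ih => exact (hS.union hS.inv).mul ih
  refine isSigmaCompact_univ_iff.1 ⟨T, hT, Set.eq_univ_of_forall fun x => ?_⟩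
  have hx : x ∈ Subgroup.closure S := hgen ▸ Subgroup.mem_top x
  induction hx using Subgroup.closure_induction_left with
  | one => exact Set.mem_iUnion.2 ⟨0, rfl⟩
  | mul_left s hs y _ ih =>
    obtain ⟨n, hn⟩ := Set.mem_iUnion.1 ih
    exact Set.mem_iUnion.2 ⟨n + 1, Set.mul_mem_mul (Or.inl hs) hn⟩
  | inv_mul_cancel s hs y _ ih =>
    obtain ⟨n, hn⟩ := Set.mem_iUnion.1 ih
    exact Set.mem_iUnion.2 ⟨n + 1, Set.mul_mem_mul (Or.inr (Set.inv_mem_inv.2 hs)) hn⟩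

/-- An open subgroup of a σ-compact group has countable index. -/
theorem Subgroup.countable_quotient_of_isOpen {G : Type*} [Group G] [TopologicalSpace G]
    [IsTopologicalGroup G] [SigmaCompactSpace G] {N : Subgroup G} (hN : IsOpen (N : Set G)) :
    Countable (G ⧸ N) := by
  have : DiscreteTopology (G ⧸ N) := QuotientGroup.discreteTopology hN
  have : SigmaCompactSpace (G ⧸ N) := by
    rw [← isSigmaCompact_univ_iff, ← Set.range_eq_univ.2 (QuotientGroup.mk_surjective (s := N))]
    exact isSigmaCompact_range QuotientGroup.continuous_mk
  exact countable_of_Lindelof_of_discrete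

/-- A closed subgroup of countable index in a Baire group is open. -/
theorem Subgroup.isOpen_of_isClosed_of_countable_quotient {G : Type*} [Group G]
    [TopologicalSpace G] [IsTopologicalGroup G] [BaireSpace G] {N : Subgroup G}
    (hN : IsClosed (N : Set G)) [Countable (G ⧸ N)] : IsOpen (N : Set G) := by
  -- Countably many closed cosets cover the group, so one has an interior point.
  obtain ⟨q, x, hx⟩ := nonempty_interior_of_iUnion_of_closed
    (f := fun q : G ⧸ N => (fun y => q.out⁻¹ * y) ⁻¹' (N : Set G))
    (fun q => hN.preimage (continuous_const_mul _))
    (Set.eq_univ_of_forall fun y => Set.mem_iUnion.2 ⟨y,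
      QuotientGroup.eq.1 (QuotientGroup.out_eq' (y : G ⧸ N))⟩)
  refine N.isOpen_of_mem_nhds (g := q.out⁻¹ * x) ?_
  have h := (isOpenMap_mul_left q.out⁻¹).image_mem_nhds (mem_interior_iff_mem_nhds.1 hx)
  exact Filter.mem_of_superset h (Set.image_preimage_subset _ _)

/-- The closed graph theorem for homomorphisms of σ-compact groups. -/
theorem MonoidHom.continuous_of_isClosed_graph {G H : Type*} [Group G] [TopologicalSpace G]
    [IsTopologicalGroup G] [T2Space G] [BaireSpace G] [SigmaCompactSpace G]
    [Group H] [TopologicalSpace H] [IsTopologicalGroup H] [SigmaCompactSpace H] (f : G →* H)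
    (hf : IsClosed (f.graph : Set (G × H))) : Continuous f := by
  have : SigmaCompactSpace f.graph := hf.isClosedEmbedding_subtypeVal.sigmaCompactSpace
  let p : f.graph →* G := (MonoidHom.fst G H).comp f.graph.subtype
  have hp : Continuous p := continuous_fst.comp continuous_subtype_val
  have hps : Function.Surjective p := fun x => ⟨⟨(x, f x), rfl⟩, rfl⟩
  -- By the open mapping theorem the projection `p` is a quotient map, so it suffices that `f ∘ p`,
  -- the second projection, is continuous.
  have hq := (p.isOpenMap_of_sigmaCompact hps hp).isQuotientMap hp hps
  refine hq.continuous_iff.2 ?_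
  convert continuous_snd.comp (continuous_subtype_val (p := (· ∈ f.graph))) using 1
  ext x
  exact x.2

/-- A group isomorphism onto a σ-compact group from a Baire group has closed graph as soon as some
core-free open subgroup of the target has closed preimage. -/
theorem MulEquiv.isClosed_graph_of_isClosed_comap {G H : Type*} [Group G] [TopologicalSpace G]
    [IsTopologicalGroup G] [SigmaCompactSpace G]
    [Group H] [TopologicalSpace H] [IsTopologicalGroup H] [BaireSpace H]
    (f : H ≃* G) {N : Subgroup G} (hN : IsOpen (N : Set G))
    (hcore : N.normalCore = ⊥) (hcl : IsClosed (N.comap f.toMonoidHom : Set H)) :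
    IsClosed (f.toMonoidHom.graph : Set (H × G)) := by
  have : Countable (G ⧸ N) := N.countable_quotient_of_isOpen hN
  have : DiscreteTopology (G ⧸ N) := QuotientGroup.discreteTopology hN
  have : Countable (H ⧸ N.comap f.toMonoidHom) := by
    refine Function.Injective.countable
      (f := fun q : H ⧸ N.comap f.toMonoidHom => (f q.out : G ⧸ N)) fun a b hab => ?_
    rw [← QuotientGroup.out_eq' a, ← QuotientGroup.out_eq' b]
    exact QuotientGroup.eq.2 (by simpa using QuotientGroup.eq.1 hab)
  have hop := Subgroup.isOpen_of_isClosed_of_countable_quotient hcl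
  have hmk : Continuous fun h : H => (f h : G ⧸ N) := by
    refine continuous_discrete_rng.2 fun q => ?_
    obtain ⟨g, rfl⟩ := QuotientGroup.mk_surjective q
    obtain ⟨a, rfl⟩ := f.surjective g
    convert hop.preimage (continuous_const_mul a⁻¹) using 1
    ext h
    simpa [eq_comm (a := (f h : G ⧸ N))] using! QuotientGroup.eq (s := N) (a := f a) (b := f h)
  -- Core-freeness enters here: `f h = g` as soon as both send every coset `bN` to the same coset.
  have hgraph : (f.toMonoidHom.graph : Set (H × G)) =
      ⋂ b : G, {p | (f (p.1 * f.symm b) : G ⧸ N) = (p.2 * b : G)} := by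
    ext ⟨h, g⟩
    simp only [SetLike.mem_coe, MonoidHom.mem_graph, Set.mem_iInter, Set.mem_ofPred_eq]
    refine ⟨fun e b => by simpa using congrArg (fun x => ((x * b : G) : G ⧸ N)) e, fun e => ?_⟩
    have hd : (f h)⁻¹ * g ∈ N.normalCore := fun b => by
      have := QuotientGroup.eq.1 (e b⁻¹)
      simpa [mul_assoc] using this
    rw [hcore, Subgroup.mem_bot] at hd
    exact (inv_mul_eq_one.1 hd)
  rw [hgraph]
  exact isClosed_iInter fun b => isClosed_eq (hmk.comp (continuous_fst.mul continuous_const))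
    (QuotientGroup.continuous_mk.comp (continuous_snd.mul continuous_const))

/-- The normaliser of the centraliser of a set is closed in any Hausdorff group topology. -/
theorem Subgroup.isClosed_comap_normalizer_centralizer {G H : Type*} [Group G] [Group H]
    [TopologicalSpace H] [IsTopologicalGroup H] [T2Space H] (f : H ≃* G) (K : Set G) :
    IsClosed (((Subgroup.normalizer (Subgroup.centralizer K : Set G)).comap
      f.toMonoidHom : Subgroup H) : Set H) := by
  have h : (((Subgroup.normalizer (Subgroup.centralizer K : Set G)).comap
      f.toMonoidHom : Subgroup H) : Set H) =
      -- Both `x` and `x⁻¹` must conjugate the centraliser into itself; each condition on `x` is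
      -- closed for fixed `c`.
      ⋂ c ∈ Set.centralizer (f ⁻¹' K),
        ((fun x => x * c * x⁻¹) ⁻¹' Set.centralizer (f ⁻¹' K)) ∩
        ((fun x => x⁻¹ * c * x) ⁻¹' Set.centralizer (f ⁻¹' K)) := by
    have hf : ∀ x, f x ∈ Set.centralizer K ↔ x ∈ Set.centralizer (f ⁻¹' K) := by
      refine fun x => ⟨fun hx k hk => f.injective (by simpa using hx (f k) hk), fun hx k hk => ?_⟩
      have := congrArg f (hx (f.symm k) (by simpa using hk))
      simpa using this
    ext x
    simp only [SetLike.mem_coe, Subgroup.mem_comap, Set.mem_iInter, Set.mem_inter_iff,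
      Set.mem_preimage]
    change f x ∈ Subgroup.normalizer _ ↔ _
    rw [Subgroup.mem_set_normalizer_iff, f.surjective.forall]
    change (∀ c, f c ∈ Set.centralizer K ↔ f x * f c * (f x)⁻¹ ∈ Set.centralizer K) ↔ _
    simp only [← map_inv, ← map_mul, hf]
    refine ⟨fun h c hc => ⟨(h c).1 hc, (h _).2 (by simpa [mul_assoc] using hc)⟩,
      fun h c => ⟨fun hc => (h c hc).1, fun hc => by simpa [mul_assoc] using (h _ hc).2⟩⟩
  rw [h]
  have hc := Set.isClosed_centralizer (f ⁻¹' K)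
  exact isClosed_biInter fun c _ =>
    (hc.preimage (by fun_prop)).inter (hc.preimage (by fun_prop))

/-! ### An open core-free subgroup from the centraliser lattice -/

theorem exists_openSubgroup_ne_top (G : Type*) [Group G] [TopologicalSpace G]
    [IsTopologicalGroup G] [T2Space G] [LocallyCompactSpace G] [TotallyDisconnectedSpace G]
    [Nontrivial G] : ∃ U : Subgroup G, IsOpen (U : Set G) ∧ U ≠ ⊤ := by
  obtain ⟨U, hU, hUo⟩ := exists_compact_open_subgroup G
  rcases ne_or_eq U ⊤ with h | rfl
  · exact ⟨U, hUo, h⟩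
  have : CompactSpace G := isCompact_univ_iff.1 hU
  obtain ⟨x, hx⟩ := exists_ne (1 : G)
  obtain ⟨W, hW, h1W, hWx⟩ := (loc_compact_Haus_tot_disc_of_zero_dim (H := G)).mem_nhds_iff.1
    (isOpen_ne.mem_nhds hx.symm)
  obtain ⟨V, hV⟩ := IsTopologicalGroup.exist_openSubgroup_sub_clopen_nhds_of_one hW h1W
  exact ⟨V, V.isOpen, fun h => hWx (hV (h ▸ Subgroup.mem_top x : x ∈ (V : Subgroup G))) rfl⟩

/-- In a non-discrete topologically simple group, open subgroups are not central. -/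
theorem IsTopologicallySimpleGroup.centralizer_ne_top {G : Type*} [Group G] [TopologicalSpace G]
    [IsTopologicalGroup G] [T2Space G] [LocallyCompactSpace G] [TotallyDisconnectedSpace G]
    (hsimple : IsTopologicallySimpleGroup G) (hnd : ¬ DiscreteTopology G) {U : Subgroup G}
    (hU : IsOpen (U : Set G)) : Subgroup.centralizer (U : Set G) ≠ ⊤ := by
  have := hsimple.1
  have hne : ∀ V : Subgroup G, IsOpen (V : Set G) → V ≠ ⊥ := by
    rintro V hV rfl
    exact hnd (discreteTopology_of_isOpen_singleton_one (by simpa using hV))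
  intro h
  have hUZ : U ≤ Subgroup.center G := fun u hu => Subgroup.mem_center_iff.2 fun g =>
    (Subgroup.mem_centralizer_iff.1 (h ▸ Subgroup.mem_top g) u hu).symm
  have hZo := Subgroup.isOpen_mono hUZ hU
  obtain hZ | hZ := hsimple.2 _ inferInstance (Subgroup.isClosed_of_isOpen _ hZo)
  · exact hne _ hZo hZ
  -- If `G` is abelian, a proper open subgroup is normal, against simplicity.
  · obtain ⟨V, hVo, hV⟩ := exists_openSubgroup_ne_top G
    have hn : V.Normal := ⟨fun v hv g => by
      have hv' : v ∈ Subgroup.center G := hZ ▸ Subgroup.mem_top v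
      rwa [Subgroup.mem_center_iff.1 hv' g, mul_inv_cancel_right]⟩
    exact (hsimple.2 V hn (Subgroup.isClosed_of_isOpen _ hVo)).elim (hne V hVo) hV

theorem commensurable_of_isCompact_of_isOpen {G : Type*} [Group G] [TopologicalSpace G]
    [IsTopologicalGroup G] {U V : Subgroup G} (hU : IsCompact (U : Set G))
    (hUo : IsOpen (U : Set G)) (hV : IsCompact (V : Set G)) (hVo : IsOpen (V : Set G)) :
    Subgroup.Commensurable U V := by
  have key : ∀ {U V : Subgroup G}, IsCompact (U : Set G) → IsOpen (V : Set G) →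
      V.relIndex U ≠ 0 := by
    intro U V hU hV
    have : CompactSpace U := isCompact_iff_compactSpace.1 hU
    have : Finite (U ⧸ V.subgroupOf U) :=
      Subgroup.quotient_finite_of_isOpen _ (Subgroup.subgroupOf_isOpen _ _ hV)
    exact Subgroup.index_ne_zero_of_finite
  exact ⟨key hV hUo, key hU hVo⟩

/-- If all such centralisers were trivial or `G`, every `C_U(K)` would be `1` or `U`. Both classes
do occur, from `K = U` and `K = ⊥`, so the lattice would be exactly `{0, ∞}`. -/
theorem exists_centralizer_of_centraliserLattice_ne {G : Type*} [Group G] [TopologicalSpace G]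
    [IsTopologicalGroup G] [T2Space G] [LocallyCompactSpace G] [TotallyDisconnectedSpace G]
    (hsimple : IsTopologicallySimpleGroup G) (hnd : ¬ DiscreteTopology G)
    (hLC : centraliserLattice G ≠ {0, StructureLattice.infty G}) :
    ∃ K : Subgroup G, IsOpen (Subgroup.normalizer (K : Set G) : Set G) ∧
      Subgroup.centralizer (K : Set G) ≠ ⊥ ∧ Subgroup.centralizer (K : Set G) ≠ ⊤ := by
  by_contra! hK
  refine hLC (Set.Subset.antisymm ?_ ?_)
  · rintro β ⟨α, K, U, hKn, hc, ho, hKU, hn, -, rfl⟩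
    have hN : U ≤ Subgroup.normalizer (K : Set G) := by
      rw [Subgroup.le_normalizer_iff]
      exact fun u hu k hk => (Subgroup.normal_subgroupOf_iff hKU).1 hn k u hk hu
    by_cases hbot : Subgroup.centralizer (K : Set G) = ⊥
    · left
      simp only [hbot, inf_bot_eq]
      rfl
    · right
      have htop := hK K (Subgroup.isOpen_mono hN ho) hbot
      simp only [htop, inf_top_eq]
      exact Quotient.sound (commensurable_of_isCompact_of_isOpen hc ho
        (exists_compact_open_subgroup G).choose_spec.1
        (exists_compact_open_subgroup G).choose_spec.2)
  · have hU := (exists_compact_open_subgroup G).choose_spec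
    set U := (exists_compact_open_subgroup G).choose
    rintro β (rfl | rfl)
    · have hbot : Subgroup.centralizer (U : Set G) = ⊥ := by
        by_contra hbot
        exact hsimple.centralizer_ne_top hnd hU.2
          (hK U (Subgroup.isOpen_mono Subgroup.le_normalizer hU.2) hbot)
      refine ⟨StructureLattice.infty G, U, U, isLocallyNormal_of_isOpen hU.1 hU.2, hU.1, hU.2,
        le_rfl, by rw [Subgroup.subgroupOf_self]; infer_instance, rfl, ?_⟩
      simp only [hbot, inf_bot_eq]
      rfl
    · refine ⟨0, ⊥, U, isLocallyNormal_bot G, hU.1, hU.2, bot_le,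
        by rw [Subgroup.bot_subgroupOf]; infer_instance, rfl, ?_⟩
      have htop : Subgroup.centralizer ((⊥ : Subgroup G) : Set G) = ⊤ := by
        simp [Subgroup.centralizer_eq_top_iff_subset]
      simp only [htop, inf_top_eq]
      rfl

theorem Subgroup.normalizer_le_normalizer_centralizer {G : Type*} [Group G] (s : Set G) :
    Subgroup.normalizer s ≤ Subgroup.normalizer (Subgroup.centralizer s : Set G) := by
  rw [Subgroup.le_normalizer_iff]
  intro n hn c hc
  refine Subgroup.mem_centralizer_iff.2 fun k hk => ?_
  have h := Subgroup.mem_centralizer_iff.1 hc _ ((Subgroup.mem_set_normalizer_iff''.1 hn k).1 hk)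
  calc k * (n * c * n⁻¹) = n * ((n⁻¹ * k * n) * c) * n⁻¹ := by group
    _ = n * (c * (n⁻¹ * k * n)) * n⁻¹ := by rw [h]
    _ = n * c * n⁻¹ * k := by group

theorem exists_open_coreFree_normalizer {G : Type*} [Group G] [TopologicalSpace G]
    [IsTopologicalGroup G] [T2Space G] [LocallyCompactSpace G] [TotallyDisconnectedSpace G]
    (hsimple : IsTopologicallySimpleGroup G) (hnd : ¬ DiscreteTopology G)
    (hLC : centraliserLattice G ≠ {0, StructureLattice.infty G}) :
    ∃ K : Set G, IsOpen (Subgroup.normalizer (Subgroup.centralizer K : Set G) : Set G) ∧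
      (Subgroup.normalizer (Subgroup.centralizer K : Set G)).normalCore = ⊥ := by
  obtain ⟨K, hK, hbot, htop⟩ := exists_centralizer_of_centraliserLattice_ne hsimple hnd hLC
  have hopen : IsOpen (Subgroup.normalizer (Subgroup.centralizer (K : Set G) : Set G) : Set G) :=
    Subgroup.isOpen_mono (Subgroup.normalizer_le_normalizer_centralizer _) hK
  refine ⟨K, hopen, (hsimple.2 _ inferInstance (Subgroup.normalCore_isClosed _
    (Subgroup.isClosed_of_isOpen _ hopen))).resolve_right fun h => ?_⟩
  have hn : (Subgroup.centralizer (K : Set G)).Normal :=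
    Subgroup.normalizer_eq_top_iff.1 (top_le_iff.1 (h ▸ Subgroup.normalCore_le _))
  exact (hsimple.2 _ hn (Set.isClosed_centralizer (K : Set G))).elim hbot htop

theorem MulEquiv.isHomeomorph_of_centraliserLattice_ne {G H : Type*} [Group G]
    [TopologicalSpace G] [IsTopologicalGroup G] [T2Space G] [LocallyCompactSpace G]
    [TotallyDisconnectedSpace G] (hgen : IsCompactlyGeneratedGroup G)
    (hsimple : IsTopologicallySimpleGroup G) (hnd : ¬ DiscreteTopology G)
    (hLC : centraliserLattice G ≠ {0, StructureLattice.infty G})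
    [Group H] [TopologicalSpace H] [IsTopologicalGroup H] [T2Space H] [LocallyCompactSpace H]
    [SigmaCompactSpace H] (f : H ≃* G) : IsHomeomorph f := by
  have := hgen.sigmaCompactSpace
  obtain ⟨K, hKo, hK⟩ := exists_open_coreFree_normalizer hsimple hnd hLC
  have hcont : Continuous f.toMonoidHom := f.toMonoidHom.continuous_of_isClosed_graph
    (f.isClosed_graph_of_isClosed_comap hKo hK (Subgroup.isClosed_comap_normalizer_centralizer f K))
  exact ⟨hcont, f.toMonoidHom.isOpenMap_of_sigmaCompact f.surjective hcont, f.bijective⟩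

theorem mainTheorem11 {G : Type*} [Group G] [τ : TopologicalSpace G] [IsTopologicalGroup G]
    [T2Space G] [LocallyCompactSpace G] [TotallyDisconnectedSpace G]
    (hgen : IsCompactlyGeneratedGroup G) (hsimple : IsTopologicallySimpleGroup G)
    (hnd : ¬ DiscreteTopology G)
    (hLC : centraliserLattice G ≠ {0, StructureLattice.infty G}) :
    (IsSigmaCompactLocallyCompactGroupTopology G τ ∧
      ∀ σ : TopologicalSpace G, IsSigmaCompactLocallyCompactGroupTopology G σ → σ = τ) ∧
    ∀ φ : G ≃* G, Continuous φ := by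
  have hσ := hgen.sigmaCompactSpace
  -- A separate type `H` keeps a second topology on `G` from clashing with the instance `τ`.
  have key : ∀ (H : Type _) [Group H] [σ : TopologicalSpace H] [IsTopologicalGroup H] [T2Space H]
      [LocallyCompactSpace H] [SigmaCompactSpace H] (f : H ≃* G), σ = τ.induced f :=
    fun H _ _ _ _ _ _ f =>
      (f.isHomeomorph_of_centraliserLattice_ne hgen hsimple hnd hLC).isInducing.eq_induced
  refine ⟨⟨⟨inferInstance, inferInstance, inferInstance, hσ⟩, fun σ h => ?_⟩, fun φ =>
    (φ.isHomeomorph_of_centraliserLattice_ne hgen hsimple hnd hLC).continuous⟩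
  exact (@key G _ σ h.isTopologicalGroup h.t2Space h.locallyCompactSpace h.sigmaCompactSpace
    (MulEquiv.refl G)).trans (@induced_id G τ)
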